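/- A (multi)hypergraph $\mathcal H$ consists of a finite vertex set $V(\mathcal H)$ and a finite family $E(\mathcal H)$ of nonempty subsets of $V(\mathcal H)$ (hyperedges, possibly repeated). A hypergraph is called $\mathcal F$-free if it has no subhypergraph isomorphic to a member of $\mathcal F$, and $\mathrm{ex}(\mathcal H,\mathcal F)$ is the maximum number of hyperedges of an $\mathcal F$-free spanning subhypergraph of $\mathcal H$. Given an ordering $\sigma$ of $E(\mathcal H)$, an alternating $2$-coloring of length $l$ with respect to $\sigma$ is an assignment of the colors red and blue to exactly $l$ hyperedges of $\mathcal H$ such that any two consecutive colored hyperedges (with respect to $\sigma$) have different colors; its red (blue) subhypergraph is the spanning subhypergraph of $\mathcal H$ whose hyperedges are the red (blue) ones. Let $\mathrm{ex}_{alt}(\mathcal H,\mathcal F,\sigma)$ (resp. $\mathrm{ex}_{salt}(\mathcal H,\mathcal F,\sigma)$) be the maximum length of an alternating $2$-coloring with respect to $\sigma$ such that both (resp. at least one) of the red and the blue subhypergraphs are $\mathcal F$-free, and let $\mathrm{ex}_{alt}(\mathcal H,\mathcal F)$ and $\mathrm{ex}_{salt}(\mathcal H,\mathcal F)$ be the minima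 of these numbers over all orderings $\sigma$ of $E(\mathcal H)$. Let $\mathrm{KG}(\mathcal H,\mathcal F)$ be the graph whose vertices are the hyperedge sets of the subhypergraphs of $\mathcal H$ isomorphic to a member of $\mathcal F$, two of them being adjacent when they are disjoint. The chromatic number of the graph with no vertices is $0$. **Lemma.** Let $\mathcal H$ be a (multi)hypergraph and let $\mathcal F$ be a family of (multi)hypergraphs, each having at least one hyperedge. Then $$|E(\mathcal H)|-\mathrm{ex}_{alt}(\mathcal H,\mathcal F)\le\chi(\mathrm{KG}(\mathcal H,\mathcal F))\le|E(\mathcal H)|-\mathrm{ex}(\mathcal H,\mathcal F).$$ If moreover $\mathcal H$ is not $\mathcal F$-free (that is, $\mathrm{KG}(\mathcal H,\mathcal F)$ has at least one vertex), then $$|E(\mathcal H)|+1-\mathrm{ex}_{salt}(\mathcal H,\mathcal F)\le\chi(\mathrm{KG}(\mathcal H,\mathcal F))\le|E(\mathcal H)|-\mathrm{ex}(\mathcal H,\mathcal F).$$ -/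

import Mathlib

universe u v

/-- A finite (multi)hypergraph: finitely many vertices, finitely many hyperedges, each hyperedge
having a nonempty vertex set. Different hyperedges may have the same vertex set. -/
structure MultiHypergraph where
  /-- the vertices -/
  V : Type u
  /-- the (labels of the) hyperedges -/
  E : Type u
  finite_V : Finite V
  finite_E : Finite E
  /-- the vertex set of a hyperedge -/
  inc : E → Set V
  inc_nonempty : ∀ e, (inc e).Nonempty

namespace MultiHypergraph

/-- The number of hyperedges, counted with multiplicity. -/
noncomputable def numEdges (H : MultiHypergraph.{u}) : ℕ := Nat.card H.E

/-- An isomorphism of (multi)hypergraphs. -/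
structure Iso (G : MultiHypergraph.{u}) (G' : MultiHypergraph.{v}) where
  onV : G.V ≃ G'.V
  onE : G.E ≃ G'.E
  inc_onE : ∀ e, G'.inc (onE e) = onV '' G.inc e

/-- A subhypergraph: some of the vertices and some of the hyperedges, such that all vertices of
each chosen hyperedge are chosen. -/
structure Sub (H : MultiHypergraph.{u}) where
  verts : Set H.V
  edges : Set H.E
  inc_subset : ∀ e ∈ edges, H.inc e ⊆ verts

/-- A subhypergraph, as a hypergraph in its own right. -/
def Sub.coe {H : MultiHypergraph.{u}} (P : H.Sub) : MultiHypergraph.{u} where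
  V := P.verts
  E := P.edges
  finite_V := by have := H.finite_V; infer_instance
  finite_E := by have := H.finite_E; infer_instance
  inc e := {w | (w : H.V) ∈ H.inc e}
  inc_nonempty e := by
    obtain ⟨w, hw⟩ := H.inc_nonempty e
    exact ⟨⟨w, P.inc_subset e e.2 hw⟩, hw⟩

/-- The spanning subhypergraph of `H` with hyperedge set `S`. -/
def spanningSub (H : MultiHypergraph.{u}) (S : Set H.E) : H.Sub where
  verts := Set.univ
  edges := S
  inc_subset _ _ := Set.subset_univ _

/-- `G` is `𝓕`-free: no subhypergraph of `G` is isomorphic to a member of `𝓕`. -/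
def IsFree (G : MultiHypergraph.{u}) (𝓕 : Set MultiHypergraph.{v}) : Prop :=
  ∀ P : G.Sub, ∀ F ∈ 𝓕, IsEmpty (Iso P.coe F)

/-- The hypergraph `H choose 𝓕`: its vertices are the hyperedges of `H`, its hyperedges are the
(nonempty) hyperedge sets of the subhypergraphs of `H` isomorphic to a member of `𝓕`. -/
def choose (H : MultiHypergraph.{u}) (𝓕 : Set MultiHypergraph.{v}) : MultiHypergraph.{u} where
  V := H.E
  E := {S : Set H.E // S.Nonempty ∧ ∃ P : H.Sub, P.edges = S ∧ ∃ F ∈ 𝓕, Nonempty (Iso P.coe F)}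
  finite_V := H.finite_E
  finite_E := by have := H.finite_E; infer_instance
  inc S := S.1
  inc_nonempty S := S.2.1

/-- The general Kneser graph `KG(H)`: its vertices are the hyperedges of `H`, two of them being
adjacent when they are disjoint. -/
def kneserGraph (H : MultiHypergraph.{u}) : SimpleGraph H.E where
  Adj e f := Disjoint (H.inc e) (H.inc f)
  symm := ⟨fun _ _ h => h.symm⟩
  loopless := ⟨fun e h => (H.inc_nonempty e).ne_empty (disjoint_self.mp h)⟩

/-- The Turán number `ex(H, 𝓕)`: the maximum number of hyperedges of an `𝓕`-free spanning
subhypergraph of `H`. -/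
noncomputable def ex (H : MultiHypergraph.{u}) (𝓕 : Set MultiHypergraph.{v}) : ℕ :=
  sSup {l | ∃ S : Set H.E, (H.spanningSub S).coe.IsFree 𝓕 ∧ S.ncard = l}

/-- An ordering `e₁, e₂, …` of all hyperedges of `H`. -/
abbrev Ordering (H : MultiHypergraph.{u}) : Type u := Fin H.numEdges ≃ H.E

/-- The two colors. -/
inductive Color
  | red
  | blue

/-- A 2-coloring of a subset of the hyperedges; `none` means that a hyperedge is not colored. -/
abbrev PartialColoring (H : MultiHypergraph.{u}) : Type u := H.E → Option Color

/-- The set of the hyperedges of a given color. -/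
def PartialColoring.colorClass {H : MultiHypergraph.{u}} (c : H.PartialColoring) (a : Color) :
    Set H.E :=
  {e | c e = some a}

/-- The length of a coloring: the number of colored hyperedges. -/
noncomputable def PartialColoring.length {H : MultiHypergraph.{u}} (c : H.PartialColoring) : ℕ :=
  {e | c e ≠ none}.ncard

/-- Any two consecutive colored hyperedges with respect to `σ` have different colors. -/
def PartialColoring.IsAlternating {H : MultiHypergraph.{u}} (c : H.PartialColoring)
    (σ : H.Ordering) : Prop :=
  ∀ i j, i < j → c (σ i) ≠ none → c (σ j) ≠ none →
    (∀ k, i < k → k < j → c (σ k) = none) → c (σ i) ≠ c (σ j)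

/-- The subhypergraph of the hyperedges of color `a`, spanning in `H`, as a hypergraph. -/
def PartialColoring.colorSub {H : MultiHypergraph.{u}} (c : H.PartialColoring) (a : Color) :
    MultiHypergraph.{u} :=
  (H.spanningSub (c.colorClass a)).coe

/-- `ex_alt(H, 𝓕, σ)`: the maximum length of an alternating 2-coloring with respect to `σ` whose
red and blue subhypergraphs are both `𝓕`-free. -/
noncomputable def exAltOrd (H : MultiHypergraph.{u}) (𝓕 : Set MultiHypergraph.{v})
    (σ : H.Ordering) : ℕ :=
  sSup {l | ∃ c : H.PartialColoring, c.IsAlternating σ ∧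
    ((c.colorSub Color.red).IsFree 𝓕 ∧ (c.colorSub Color.blue).IsFree 𝓕) ∧ c.length = l}

/-- `ex_salt(H, 𝓕, σ)`: the maximum length of an alternating 2-coloring with respect to `σ` such
that at least one of the red and the blue subhypergraph is `𝓕`-free. -/
noncomputable def exSaltOrd (H : MultiHypergraph.{u}) (𝓕 : Set MultiHypergraph.{v})
    (σ : H.Ordering) : ℕ :=
  sSup {l | ∃ c : H.PartialColoring, c.IsAlternating σ ∧
    ((c.colorSub Color.red).IsFree 𝓕 ∨ (c.colorSub Color.blue).IsFree 𝓕) ∧ c.length = l}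

/-- The alternating Turán number `ex_alt(H, 𝓕)`: the minimum over all orderings. -/
noncomputable def exAlt (H : MultiHypergraph.{u}) (𝓕 : Set MultiHypergraph.{v}) : ℕ :=
  ⨅ σ : H.Ordering, H.exAltOrd 𝓕 σ

/-- The strong alternating Turán number `ex_salt(H, 𝓕)`: the minimum over all orderings. -/
noncomputable def exSalt (H : MultiHypergraph.{u}) (𝓕 : Set MultiHypergraph.{v}) : ℕ :=
  ⨅ σ : H.Ordering, H.exSaltOrd 𝓕 σ

end MultiHypergraph

/-! Upper bound: fix a largest `𝓕`-free hyperedge set `S` and color each copy of a member of `𝓕` by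
one of its hyperedges outside `S`. Copies with a common color meet, so this is a proper coloring by
the complement of `S`.

Lower bounds: partial 2-colorings of the hyperedges are signed vectors, with `swapColors` as
antipodal map and `Extends` as order. The topological input is Tucker's lemma in the form
`card_le_of_monotone_of_antipodal`: a monotone function with values at most `m` that separates every
nonzero `X` from its antipode forces at most `m` coordinates. It follows from a mod 2 form of Ky
Fan's theorem, `exists_alternating_chain`, proved by building the sphere as a cycle of chains.

Let `α` be the alternating Turán number of an ordering and let a proper `t`-coloring of the Kneser
graph be given. If no alternating subcoloring of `X` is longer than `α`, the value at `X` is the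
length of the longest one starting with red; otherwise it is `α` plus the largest color of a red
copy, or `α` if there is none. Values are at most `α + t`. Antipodes are separated in the first case
because the first colored hyperedge decides which start is better, and in the second because a red
and a blue copy are disjoint, hence differently colored. In the strong version both colors contain
copies, so every color can be lowered by one. -/

namespace MultiHypergraph

/-- The other color. -/
def Color.swap : Color → Color
  | red => blue
  | blue => red

@[simp] theorem Color.swap_swap (a : Color) : a.swap.swap = a := by cases a <;> rfl

theorem Color.swap_ne (a : Color) : a.swap ≠ a := by cases a <;> simp [Color.swap]

/-! ### Signed vectors and the antipodal map -/

section SignedVectors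

variable {E : Type u}

/-- Exchange the two colors of a partial 2-coloring. -/
def swapColors (X : E → Option Color) : E → Option Color := fun e => (X e).map Color.swap

/-- Every element colored by `X` has the same color in `Y`. -/
def Extends (X Y : E → Option Color) : Prop := ∀ e a, X e = some a → Y e = some a

@[simp] theorem swapColors_swapColors (X : E → Option Color) :
    swapColors (swapColors X) = X := by
  funext e
  cases h : X e <;> simp [swapColors, h]

theorem swapColors_eq_none {X : E → Option Color} {e : E} :
    swapColors X e = none ↔ X e = none := by simp [swapColors]

theorem swapColors_eq_some {X : E → Option Color} {e : E} {a : Color} :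
    swapColors X e = some a ↔ X e = some a.swap := by
  cases h : X e with
  | none => simp [swapColors, h]
  | some b => cases a <;> cases b <;> simp [swapColors, h, Color.swap]

theorem Extends.trans {X Y Z : E → Option Color} (h : Extends X Y) (h' : Extends Y Z) :
    Extends X Z := fun e _ ha => h' e _ (h e _ ha)

theorem Extends.swapColors {X Y : E → Option Color} (h : Extends X Y) :
    Extends (swapColors X) (swapColors Y) := fun e _ ha =>
  swapColors_eq_some.2 (h e _ (swapColors_eq_some.1 ha))

theorem swapColors_ne_none {X : E → Option Color} (hX : X ≠ fun _ => none) :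
    swapColors X ≠ fun _ => none := fun h =>
  hX (funext fun e => swapColors_eq_none.1 (congrFun h e))

end SignedVectors

/-! ### Mod 2 cochains on ordered simplices -/

section Cochains

variable {V : Type u}

/-- The coboundary modulo 2 of a function on lists. -/
def coboundary : (List V → ZMod 2) → List V → ZMod 2
  | _, [] => 0
  | f, a :: l => f l + coboundary (fun l' => f (a :: l')) l

/-- The dual of the prism operator from the identity to `g`. -/
def prism (g : V → V) : (List V → ZMod 2) → List V → ZMod 2
  | _, [] => 0
  | f, a :: l => f (a :: g a :: l.map g) + prism g (fun l' => f (a :: l')) l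

/-- The indicator function of the lists with alternating signs, the first one being `b`. -/
def altIndicator (s : V → Bool) : Bool → List V → ZMod 2
  | _, [] => 1
  | b, a :: l => if s a = b then altIndicator s (!b) l else 0

theorem coboundary_add (f g : List V → ZMod 2) (l : List V) :
    coboundary (fun l' => f l' + g l') l = coboundary f l + coboundary g l := by
  induction l generalizing f g with
  | nil => simp [coboundary]
  | cons a l ih => simp only [coboundary, ih]; ring

theorem prism_add (p : V → V) (f g : List V → ZMod 2) (l : List V) :
    prism p (fun l' => f l' + g l') l = prism p f l + prism p g l := by
  induction l generalizing f g with
  | nil => simp [prism]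
  | cons a l ih => simp only [prism, ih]; ring

theorem coboundary_map (p : V → V) (f : List V → ZMod 2) (l : List V) :
    coboundary f (l.map p) = coboundary (fun l' => f (l'.map p)) l := by
  induction l generalizing f with
  | nil => simp [coboundary]
  | cons a l ih => simp [coboundary, ih]

/-- The dual of the chain homotopy between the identity and `p`. All signs disappear modulo 2. -/
theorem prism_coboundary (p : V → V) (f : List V → ZMod 2) (l : List V) :
    prism p (coboundary f) l = coboundary (prism p f) l + f l + f (l.map p) := by
  induction l generalizing f with
  | nil =>
    simp only [prism, coboundary, List.map_nil]
    linear_combination -CharTwo.add_self_eq_zero (f [])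
  | cons a l ih =>
    simp only [prism, coboundary, List.map_cons, prism_add, coboundary_add, ih, coboundary_map]
    linear_combination CharTwo.add_self_eq_zero (f (a :: List.map p l))

theorem prism_congr (p : V → V) {f g : List V → ZMod 2} {l : List V}
    (h : ∀ l₁ a l₂, l = l₁ ++ a :: l₂ →
      f (l₁ ++ a :: p a :: l₂.map p) = g (l₁ ++ a :: p a :: l₂.map p)) :
    prism p f l = prism p g l := by
  induction l generalizing f g with
  | nil => rfl
  | cons a l ih =>
    simp only [prism]
    rw [show f (a :: p a :: l.map p) = g (a :: p a :: l.map p) from h [] a l rfl]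
    rw [ih (f := fun l' => f (a :: l')) (g := fun l' => g (a :: l'))]
    intro l₁ b l₂ hl
    exact h (a :: l₁) b l₂ (by simp [hl])

/-- In an alternating list of length at least 2, only deleting an end leaves it alternating:
deleting the last entry keeps the first sign, deleting the first entry flips it. In any other list,
alternating results come in pairs with the same first sign, from deleting either entry of an
adjacent equal pair, and cancel. -/
theorem coboundary_altIndicator (s : V → Bool) (b : Bool) (l : List V) :
    coboundary (altIndicator s b) l = altIndicator s b l + altIndicator s (!b) l := by
  induction l generalizing b with
  | nil => simp only [coboundary, altIndicator]; exact (CharTwo.add_self_eq_zero 1).symm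
  | cons a l ih =>
    have h0 : ∀ l : List V, coboundary (fun _ => 0) l = 0 := by
      intro l
      induction l with
      | nil => rfl
      | cons a l ih => simp [coboundary, ih]
    by_cases h : s a = b
    · have h' : s a ≠ !b := by simp [h]
      simp only [coboundary, altIndicator, h, if_true, ih]
      have := CharTwo.add_self_eq_zero (altIndicator s b l)
      simp
      linear_combination this
    · have h' : s a = !b := by cases b <;> simpa using h
      simp [coboundary, altIndicator, h', h0]

theorem altIndicator_map {s : V → Bool} {p : V → V} {l : List V}
    (h : ∀ a ∈ l, s (p a) = !s a) (b : Bool) :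
    altIndicator s b (l.map p) = altIndicator s (!b) l := by
  induction l generalizing b with
  | nil => rfl
  | cons a l ih =>
    have ih' := ih (fun c hc => h c (List.mem_cons_of_mem _ hc))
    have ha := h a List.mem_cons_self
    simp only [List.map_cons, altIndicator, ih', ha]
    cases b <;> cases s a <;> rfl

end Cochains

/-! ### The Fan and Tucker lemmas -/

section AlternatingChains

variable {E : Type u}

/-- Chains of nonzero signed vectors supported in `S`, as many as `S` has elements. -/
def IsFullChain (S : Finset E) (l : List (E → Option Color)) : Prop :=
  l.length = S.card ∧ l.Pairwise Extends ∧
    ∀ X ∈ l, X ≠ (fun _ => none) ∧ ∀ e ∉ S, X e = none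

theorem IsFullChain.map_swapColors {S : Finset E} {l : List (E → Option Color)}
    (h : IsFullChain S l) : IsFullChain S (l.map swapColors) := by
  refine ⟨by simpa using h.1, ?_, ?_⟩
  · rw [List.pairwise_map]
    exact h.2.1.imp Extends.swapColors
  · intro X hX
    obtain ⟨Y, hY, rfl⟩ := List.mem_map.1 hX
    exact ⟨swapColors_ne_none (h.2.2 Y hY).1, fun e he =>
      swapColors_eq_none.2 ((h.2.2 Y hY).2 e he)⟩

variable [DecidableEq E]

/-- Color `e` red. -/
def colorRed (e : E) (X : E → Option Color) : E → Option Color :=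
  Function.update X e (some Color.red)

theorem extends_colorRed {e : E} {X : E → Option Color} (h : X e = none) :
    Extends X (colorRed e X) := by
  intro d a hd
  have : d ≠ e := by rintro rfl; simp [h] at hd
  simpa [colorRed, this] using hd

theorem Extends.colorRed {X Y : E → Option Color} (h : Extends X Y) (e : E) :
    Extends (colorRed e X) (colorRed e Y) := by
  intro d a hd
  by_cases hde : d = e
  · subst hde; simpa [MultiHypergraph.colorRed] using hd
  · simp only [MultiHypergraph.colorRed, Function.update_of_ne hde] at hd ⊢
    exact h d a hd

theorem colorRed_ne_none (e : E) (X : E → Option Color) : colorRed e X ≠ fun _ => none := by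
  intro h
  simpa [colorRed] using congrFun h e

theorem colorRed_eq_none {e d : E} {S : Finset E} {X : E → Option Color}
    (hX : ∀ d ∉ S, X d = none) (hd : d ∉ insert e S) : colorRed e X d = none := by
  simp only [Finset.mem_insert, not_or] at hd
  simpa [colorRed, hd.1] using hX d hd.2

/-- The simplices of the prism over a full chain are full chains in one dimension more. With
`IsFullChain.cone`, this keeps the inductive construction of the sphere within full chains. -/
theorem IsFullChain.prism {S : Finset E} {e : E} (he : e ∉ S) {l₁ l₂ : List (E → Option Color)}
    {X : E → Option Color} (h : IsFullChain S (l₁ ++ X :: l₂)) :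
    IsFullChain (insert e S) (l₁ ++ X :: colorRed e X :: l₂.map (colorRed e)) := by
  obtain ⟨h1, h2, h3⟩ := h
  have hext : ∀ Y ∈ l₁ ++ X :: l₂, Extends Y (MultiHypergraph.colorRed e Y) := fun Y hY =>
    extends_colorRed ((h3 Y hY).2 e he)
  rw [List.pairwise_append, List.pairwise_cons] at h2
  obtain ⟨h21, ⟨h22, h23⟩, h24⟩ := h2
  refine ⟨by simp [Finset.card_insert_of_notMem he] at h1 ⊢; omega, ?_, ?_⟩
  · rw [List.pairwise_append, List.pairwise_cons, List.pairwise_cons, List.pairwise_map]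
    refine ⟨h21, ⟨?_, ?_, h23.imp (fun h => h.colorRed e)⟩, ?_⟩
    · intro Y hY
      rcases List.mem_cons.1 hY with rfl | hY
      · exact hext X (by simp)
      · obtain ⟨Z, hZ, rfl⟩ := List.mem_map.1 hY
        exact (h22 Z hZ).trans (hext Z (by simp [hZ]))
    · intro Y hY
      obtain ⟨Z, hZ, rfl⟩ := List.mem_map.1 hY
      exact (h22 Z hZ).colorRed e
    · intro W hW Y hY
      rcases List.mem_cons.1 hY with rfl | hY
      · exact h24 W hW _ (by simp)
      rcases List.mem_cons.1 hY with rfl | hY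
      · exact (h24 W hW X (by simp)).trans (hext X (by simp))
      · obtain ⟨Z, hZ, rfl⟩ := List.mem_map.1 hY
        exact (h24 W hW Z (by simp [hZ])).trans (hext Z (by simp [hZ]))
  · have old : ∀ Y ∈ l₁ ++ X :: l₂, Y ≠ (fun _ => none) ∧ ∀ d ∉ insert e S, Y d = none :=
      fun Y hY => ⟨(h3 Y hY).1, fun d hd =>
        (h3 Y hY).2 d (fun h => hd (Finset.mem_insert_of_mem h))⟩
    have new : ∀ Y ∈ l₁ ++ X :: l₂, MultiHypergraph.colorRed e Y ≠ (fun _ => none) ∧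
        ∀ d ∉ insert e S, MultiHypergraph.colorRed e Y d = none :=
      fun Y hY => ⟨colorRed_ne_none e Y, fun d hd => colorRed_eq_none (h3 Y hY).2 hd⟩
    intro Y hY
    simp only [List.mem_append, List.mem_cons, List.mem_map] at hY
    rcases hY with hY | rfl | rfl | ⟨Z, hZ, rfl⟩
    · exact old Y (by simp [hY])
    · exact old Y (by simp)
    · exact new X (by simp)
    · exact new Z (by simp [hZ])

theorem IsFullChain.cone {S : Finset E} {e : E} (he : e ∉ S) {l : List (E → Option Color)}
    (h : IsFullChain S l) :
    IsFullChain (insert e S) (colorRed e (fun _ => none) :: l.map (colorRed e)) := by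
  obtain ⟨h1, h2, h3⟩ := h
  refine ⟨by simp [Finset.card_insert_of_notMem he, h1], ?_, ?_⟩
  · rw [List.pairwise_cons, List.pairwise_map]
    refine ⟨?_, h2.imp (fun h => h.colorRed e)⟩
    intro Y hY
    obtain ⟨Z, hZ, rfl⟩ := List.mem_map.1 hY
    exact Extends.colorRed (fun d a hd => by simp at hd) e
  · intro Y hY
    rcases List.mem_cons.1 hY with rfl | hY
    · exact ⟨colorRed_ne_none _ _, fun d hd => colorRed_eq_none (fun _ _ => rfl) hd⟩
    · obtain ⟨Z, hZ, rfl⟩ := List.mem_map.1 hY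
      exact ⟨colorRed_ne_none _ _, fun d hd => colorRed_eq_none (h3 Z hZ).2 hd⟩

/-- A cycle modulo 2 of full chains, invariant under the antipodal map, on which the number of
alternating chains is odd for every antipodal sign function. -/
theorem exists_antipodal_cycle (S : Finset E) :
    ∃ Z : (List (E → Option Color) → ZMod 2) → ZMod 2,
      (∀ f g, Z (fun l => f l + g l) = Z f + Z g) ∧
      (∀ f g, (∀ l, IsFullChain S l → f l = g l) → Z f = Z g) ∧
      (∀ f, Z (coboundary f) = 0) ∧
      (∀ f, Z (fun l => f (l.map swapColors)) = Z f) ∧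
      (∀ s : (E → Option Color) → Bool,
        (∀ X, X ≠ (fun _ => none) → s (swapColors X) = !s X) →
          ∀ b, Z (altIndicator s b) = 1) := by
  induction S using Finset.induction_on with
  | empty =>
    exact ⟨fun f => f [], fun _ _ => rfl, fun f g h => h [] ⟨rfl, by simp, by simp⟩,
      fun _ => rfl, fun _ => rfl, fun _ _ _ => rfl⟩
  | insert e S he ih =>
    obtain ⟨Z, hadd, hcongr, hcycle, hswap, halt⟩ := ih
    -- A hemisphere with boundary `Z`: a prism carries `Z` to its image with `e` red, and a cone
    -- closes that image at the vector whose only colored entry is `e`.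
    let h : (List (E → Option Color) → ZMod 2) → ZMod 2 := fun f =>
      Z (fun l => prism (colorRed e) f l + f (colorRed e (fun _ => none) :: l.map (colorRed e)))
    have h_add : ∀ f g, h (fun l => f l + g l) = h f + h g := by
      intro f g
      simp only [h, ← hadd, prism_add]
      congr 1
      funext l
      ring
    have h_congr : ∀ f g, (∀ l, IsFullChain (insert e S) l → f l = g l) → h f = h g := by
      intro f g hfg
      refine hcongr _ _ fun l hl => ?_
      rw [hfg _ (hl.cone he), prism_congr]
      rintro l₁ X l₂ rfl
      exact hfg _ (hl.prism he)
    have h_coboundary : ∀ f, h (coboundary f) = Z f := by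
      intro f
      have key : ∀ l, prism (colorRed e) (coboundary f) l +
          coboundary f (colorRed e (fun _ => none) :: l.map (colorRed e)) =
          (coboundary (prism (colorRed e) f) l + coboundary (fun l' =>
            f (colorRed e (fun _ => none) :: l'.map (colorRed e))) l) + f l := by
        intro l
        rw [prism_coboundary]
        simp only [coboundary, coboundary_map]
        linear_combination CharTwo.add_self_eq_zero (f (l.map (colorRed e)))
      simp only [h]
      rw [funext key, hadd, hadd, hcycle, hcycle, zero_add, zero_add]
    -- The new sphere is the hemisphere plus its antipode; the two boundaries agree because `Z` is
    -- antipodally invariant.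
    refine ⟨fun f => h f + h (fun l => f (l.map swapColors)), ?_, ?_, ?_, ?_, ?_⟩
    · intro f g
      simp only [h_add]
      ring
    · intro f g hfg
      simp only
      rw [h_congr f g hfg, h_congr _ _ fun l hl => hfg _ hl.map_swapColors]
    · intro f
      have : (fun l => coboundary f (l.map swapColors)) =
          coboundary (fun l => f (l.map swapColors)) := funext fun l => coboundary_map _ _ _
      simp only [this, h_coboundary, hswap]
      exact CharTwo.add_self_eq_zero _
    · intro f
      have : swapColors ∘ swapColors = (id : (E → Option Color) → _) :=
        funext swapColors_swapColors
      simp only [List.map_map, this, List.map_id]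
      exact add_comm _ _
    -- The antipode exchanges the two starting signs, so the sum is `h` of a coboundary, which is
    -- the count on the lower-dimensional sphere.
    · intro s hs b
      have h1 : h (fun l => altIndicator s b (l.map swapColors)) = h (altIndicator s (!b)) :=
        h_congr _ _ fun l hl => altIndicator_map (fun X hX => hs X (hl.2.2 X hX).1) b
      have h2 : coboundary (altIndicator s b) =
          fun l => altIndicator s b l + altIndicator s (!b) l :=
        funext fun l => coboundary_altIndicator s b l
      simp only
      rw [h1, ← h_add, ← h2, h_coboundary, halt s hs b]

theorem exists_alternating_chain [Fintype E] (s : (E → Option Color) → Bool)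
    (hs : ∀ X, X ≠ (fun _ => none) → s (swapColors X) = !s X) :
    ∃ l, IsFullChain (Finset.univ : Finset E) l ∧ altIndicator s true l ≠ 0 := by
  obtain ⟨Z, hadd, hcongr, -, -, halt⟩ := exists_antipodal_cycle (Finset.univ : Finset E)
  by_contra! hno
  have h1 : Z (altIndicator s true) = Z (fun _ => 0) := hcongr _ _ hno
  have h2 : Z (fun _ => 0) = 0 := by simpa using hadd (fun _ => 0) (fun _ => 0)
  rw [halt s hs, h2] at h1
  exact one_ne_zero h1

/-- A version of Tucker's lemma. -/
theorem card_le_of_monotone_of_antipodal [Fintype E] {m : ℕ} (F : (E → Option Color) → ℕ)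
    (hmono : ∀ X Y, Extends X Y → F X ≤ F Y)
    (hne : ∀ X, X ≠ (fun _ => none) → F X ≠ F (swapColors X)) (hle : ∀ X, F X ≤ m) :
    Fintype.card E ≤ m := by
  let s : (E → Option Color) → Bool := fun X => decide (F (swapColors X) < F X)
  let lev : (E → Option Color) → ℕ := fun X => max (F X) (F (swapColors X))
  obtain ⟨l, ⟨hlen, hl, hsupp⟩, halt⟩ := exists_alternating_chain s (by
    intro X hX
    have := hne X hX
    by_cases h : F (swapColors X) < F X
    · simp [s, h, h.le]
    · simp [s, h]; omega)
  -- Both `F X` and `F (swapColors X)` can only grow. If their maximum stayed the same, the side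
  -- attaining it would still attain it at `Y`, and the sign would not change.
  have step : ∀ X Y, Y ≠ (fun _ => none) → Extends X Y → s X ≠ s Y → lev X < lev Y := by
    intro X Y hY hXY hs
    have h0 := hne Y hY
    have h1 := hmono X Y hXY
    have h2 := hmono _ _ hXY.swapColors
    by_contra! hlt
    apply hs
    simp only [s, lev, decide_eq_decide] at hlt ⊢
    omega
  have hlev : ∀ (l : List (E → Option Color)) (X : E → Option Color) (b : Bool),
      (∀ Y ∈ l, Y ≠ fun _ => none) → (X :: l).Pairwise Extends →
        altIndicator s b (X :: l) ≠ 0 → lev X + l.length ≤ m := by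
    intro l
    induction l with
    | nil => intro X b _ _ _; exact max_le (hle _) (hle _)
    | cons Y l ih =>
      intro X b hl hp ha
      simp only [altIndicator, ne_eq, ite_eq_right_iff, Classical.not_imp] at ha
      rw [List.pairwise_cons] at hp
      have hY := ih Y (!b) (fun W hW => hl W (by simp [hW])) hp.2
        (by simpa [altIndicator] using ha.2)
      have := step X Y (hl Y (by simp)) (hp.1 Y (by simp)) (by rw [ha.1, ha.2.1]; simp)
      simp only [List.length_cons]
      omega
  rw [← Finset.card_univ, ← hlen]
  cases l with
  | nil => simp
  | cons X l =>
    have h1 := hlev l X true (fun Y hY => (hsupp Y (by simp [hY])).1) hl halt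
    -- Two distinct natural numbers have a positive maximum; each later member of the chain raises
    -- the level by at least 1.
    have h2 : 1 ≤ lev X := by
      have := hne X (hsupp X (by simp)).1
      simp only [lev]
      omega
    simp only [List.length_cons]
    omega

end AlternatingChains

section Hypergraphs

variable {H : MultiHypergraph.{u}} {𝓕 : Set MultiHypergraph.{v}}

/-! ### Copies of members of `𝓕`, and the upper bound -/

section Copies

/-- A subhypergraph of a spanning subhypergraph, as a subhypergraph of the ambient one. -/
def Sub.ofSpanning {S : Set H.E} (P : (H.spanningSub S).coe.Sub) : H.Sub where
  verts := {w | ⟨w, trivial⟩ ∈ P.verts}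
  edges := {e | ∃ h : e ∈ S, ⟨e, h⟩ ∈ P.edges}
  inc_subset e he w hw := by
    obtain ⟨h, he⟩ := he
    exact P.inc_subset ⟨e, h⟩ he hw

/-- A subhypergraph all of whose hyperedges lie in `S`, as a subhypergraph of the spanning
subhypergraph with hyperedge set `S`. -/
def Sub.toSpanning {S : Set H.E} (P : H.Sub) : (H.spanningSub S).coe.Sub where
  verts := {w | w.1 ∈ P.verts}
  edges := {e | e.1 ∈ P.edges}
  inc_subset e he _ hw := P.inc_subset e.1 he hw

theorem Iso.trans_nonempty {A B : MultiHypergraph.{u}} {F : MultiHypergraph.{v}} (f : Iso A B)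
    (g : Iso B F) : Nonempty (Iso A F) :=
  ⟨{ onV := f.onV.trans g.onV
     onE := f.onE.trans g.onE
     inc_onE := fun e => by
       simp only [Equiv.trans_apply, g.inc_onE, f.inc_onE, Set.image_image, Equiv.coe_trans,
         Function.comp_apply] }⟩

theorem Sub.ofSpanning_iso {S : Set H.E} (P : (H.spanningSub S).coe.Sub) :
    Nonempty (Iso (Sub.ofSpanning P).coe P.coe) :=
  ⟨{ onV :=
      { toFun := fun w => ⟨⟨w.1, trivial⟩, w.2⟩
        invFun := fun w => ⟨w.1.1, w.2⟩
        left_inv := fun _ => rfl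
        right_inv := fun _ => rfl }
     onE :=
      { toFun := fun e => ⟨⟨e.1, e.2.1⟩, e.2.2⟩
        invFun := fun e => ⟨e.1.1, e.1.2, e.2⟩
        left_inv := fun _ => rfl
        right_inv := fun _ => rfl }
     inc_onE := fun e => by
      ext w
      exact ⟨fun hw => ⟨⟨w.1.1, w.2⟩, hw, rfl⟩, by rintro ⟨x, hx, rfl⟩; exact hx⟩ }⟩

theorem Sub.toSpanning_iso {S : Set H.E} (P : H.Sub) (h : P.edges ⊆ S) :
    Nonempty (Iso (P.toSpanning (S := S)).coe P.coe) :=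
  ⟨{ onV :=
      { toFun := fun w => ⟨w.1.1, w.2⟩
        invFun := fun w => ⟨⟨w.1, trivial⟩, w.2⟩
        left_inv := fun _ => rfl
        right_inv := fun _ => rfl }
     onE :=
      { toFun := fun e => ⟨e.1.1, e.2⟩
        invFun := fun e => ⟨⟨e.1, h e.2⟩, e.2⟩
        left_inv := fun _ => rfl
        right_inv := fun _ => rfl }
     inc_onE := fun e => by
      ext w
      exact ⟨fun hw => ⟨⟨⟨w.1, trivial⟩, w.2⟩, hw, rfl⟩, by rintro ⟨x, hx, rfl⟩; exact hx⟩ }⟩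

theorem exists_choose_edge (h𝓕 : ∀ F ∈ 𝓕, Nonempty F.E) {P : H.Sub} {F : MultiHypergraph.{v}}
    (hF : F ∈ 𝓕) (i : Iso P.coe F) : ∃ A : (H.choose 𝓕).E, A.1 = P.edges := by
  obtain ⟨f⟩ := h𝓕 F hF
  exact ⟨⟨P.edges, ⟨(i.onE.symm f).1, (i.onE.symm f).2⟩, P, rfl, F, hF, ⟨i⟩⟩, rfl⟩

/-- Freeness depends on hyperedge sets alone, since a spanning subhypergraph keeps all vertices. The
hypothesis `h𝓕` makes the hyperedge set of every copy nonempty, hence a member of `H.choose 𝓕`. -/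
theorem spanningSub_isFree_iff (h𝓕 : ∀ F ∈ 𝓕, Nonempty F.E) (S : Set H.E) :
    (H.spanningSub S).coe.IsFree 𝓕 ↔ ∀ A : (H.choose 𝓕).E, ¬ A.1 ⊆ S := by
  constructor
  · rintro h ⟨_, _, P, rfl, F, hF, ⟨i⟩⟩ hS
    obtain ⟨j⟩ := P.toSpanning_iso hS
    obtain ⟨k⟩ := j.trans_nonempty i
    exact (h _ F hF).false k
  · intro h P F hF
    refine ⟨fun i => ?_⟩
    obtain ⟨j⟩ := Sub.ofSpanning_iso P
    obtain ⟨k⟩ := j.trans_nonempty i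
    obtain ⟨A, hA⟩ := exists_choose_edge h𝓕 hF k
    exact h A (hA ▸ fun e he => he.1)

theorem nonempty_choose_edges (h𝓕 : ∀ F ∈ 𝓕, Nonempty F.E) (h : ¬ H.IsFree 𝓕) :
    Nonempty (H.choose 𝓕).E := by
  simp only [IsFree, not_forall, not_isEmpty_iff] at h
  obtain ⟨P, F, hF, ⟨i⟩⟩ := h
  obtain ⟨A, -⟩ := exists_choose_edge h𝓕 hF i
  exact ⟨A⟩

theorem chromaticNumber_add_ex_le (h𝓕 : ∀ F ∈ 𝓕, Nonempty F.E) :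
    (H.choose 𝓕).kneserGraph.chromaticNumber + (H.ex 𝓕 : ℕ∞) ≤ (H.numEdges : ℕ∞) := by
  have := H.finite_E
  obtain ⟨S, hS, hex⟩ : ∃ S : Set H.E, (H.spanningSub S).coe.IsFree 𝓕 ∧ S.ncard = H.ex 𝓕 := by
    have hbdd : BddAbove {l | ∃ S : Set H.E, (H.spanningSub S).coe.IsFree 𝓕 ∧ S.ncard = l} := by
      refine ⟨H.numEdges, ?_⟩
      rintro _ ⟨S, -, rfl⟩
      exact Set.ncard_le_card S
    refine Nat.sSup_mem ?_ hbdd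
    refine ⟨0, ∅, ?_, Set.ncard_empty _⟩
    rw [spanningSub_isFree_iff h𝓕]
    exact fun A hA => A.2.1.ne_empty (Set.subset_empty_iff.1 hA)
  rw [spanningSub_isFree_iff h𝓕] at hS
  have hpick : ∀ A : (H.choose 𝓕).E, ∃ e : (Sᶜ : Set H.E), (e : H.E) ∈ A.1 := fun A => by
    obtain ⟨e, he, heS⟩ := Set.not_subset.1 (hS A)
    exact ⟨⟨e, heS⟩, he⟩
  choose c hc using hpick
  have hcol : (H.choose 𝓕).kneserGraph.Colorable (Sᶜ : Set H.E).ncard := by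
    have := Fintype.ofFinite (Sᶜ : Set H.E)
    rw [← Nat.card_coe_set_eq, Nat.card_eq_fintype_card]
    refine SimpleGraph.Coloring.colorable (SimpleGraph.Coloring.mk c ?_)
    intro A B hAB h
    exact Set.disjoint_left.1 hAB (hc A) (h ▸ hc B)
  calc _ ≤ ((Sᶜ : Set H.E).ncard : ℕ∞) + (S.ncard : ℕ∞) :=
        add_le_add hcol.chromaticNumber_le (by rw [hex])
    _ = (H.numEdges : ℕ∞) := by
        rw [add_comm, ← Nat.cast_add, Set.ncard_add_ncard_compl]; rfl

end Copies

/-! ### Longest alternating subcolorings -/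

section Alternating

theorem IsAlternating.swapColors {c : H.PartialColoring} {σ : H.Ordering}
    (h : c.IsAlternating σ) : PartialColoring.IsAlternating (swapColors c) σ := by
  intro i j hij hi hj hk heq
  simp only [ne_eq, swapColors_eq_none] at hi hj hk
  refine h i j hij hi hj hk ?_
  obtain ⟨a, ha⟩ := Option.ne_none_iff_exists'.1 hi
  have h1 := swapColors_eq_some (a := a.swap).2 (by simpa using ha)
  rw [heq] at h1
  simpa [ha] using (swapColors_eq_some.1 h1).symm

/-- The first colored hyperedge, if there is one, has color `a`. -/
def StartsWith (σ : H.Ordering) (a : Color) (c : H.PartialColoring) : Prop :=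
  ∀ i, c (σ i) ≠ none → (∀ k < i, c (σ k) = none) → c (σ i) = some a

theorem StartsWith.swapColors {c : H.PartialColoring} {σ : H.Ordering} {a : Color}
    (h : StartsWith σ a c) : StartsWith σ a.swap (swapColors c) := by
  intro i hi hk
  simp only [ne_eq, swapColors_eq_none] at hi hk
  exact swapColors_eq_some.2 (by simpa using h i hi hk)

theorem length_swapColors (c : H.PartialColoring) :
    PartialColoring.length (swapColors c) = c.length := by
  simp [PartialColoring.length, swapColors_eq_none]

theorem PartialColoring.length_le (c : H.PartialColoring) : c.length ≤ H.numEdges := by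
  have := H.finite_E
  exact Set.ncard_le_card _

/-- The maximum length of an alternating subcoloring of `X` that starts with red. -/
noncomputable def redAltLength (σ : H.Ordering) (X : H.PartialColoring) : ℕ :=
  sSup {l | ∃ c : H.PartialColoring, c.IsAlternating σ ∧ StartsWith σ Color.red c ∧
    Extends c X ∧ c.length = l}

theorem redAltLength_bddAbove (σ : H.Ordering) (X : H.PartialColoring) :
    BddAbove {l | ∃ c : H.PartialColoring, c.IsAlternating σ ∧ StartsWith σ Color.red c ∧
    Extends c X ∧ c.length = l} := by
  refine ⟨H.numEdges, ?_⟩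
  rintro _ ⟨c, -, -, -, rfl⟩
  exact c.length_le

theorem exists_length_eq_redAltLength (σ : H.Ordering) (X : H.PartialColoring) :
    ∃ c : H.PartialColoring, c.IsAlternating σ ∧ StartsWith σ Color.red c ∧
      Extends c X ∧ c.length = redAltLength σ X := by
  refine Nat.sSup_mem ?_ (redAltLength_bddAbove σ X)
  refine ⟨0, fun _ => none, ?_, ?_, ?_, ?_⟩
  · intro i j _ hi; exact absurd rfl hi
  · intro i hi; exact absurd rfl hi
  · intro e a h; simp at h
  · simp [PartialColoring.length]

theorem length_le_redAltLength {σ : H.Ordering} {X c : H.PartialColoring}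
    (h : c.IsAlternating σ) (hs : StartsWith σ Color.red c) (hX : Extends c X) :
    c.length ≤ redAltLength σ X :=
  le_csSup (redAltLength_bddAbove σ X) ⟨c, h, hs, hX, rfl⟩

theorem redAltLength_mono {σ : H.Ordering} {X Y : H.PartialColoring} (h : Extends X Y) :
    redAltLength σ X ≤ redAltLength σ Y := by
  obtain ⟨c, h1, h2, h3, h4⟩ := exists_length_eq_redAltLength σ X
  rw [← h4]
  exact length_le_redAltLength h1 h2 (h3.trans h)

open Classical in
/-- An alternating coloring can be prolonged at its front. -/
theorem exists_prepend {σ : H.Ordering} {a : Color} {X c : H.PartialColoring}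
    (h : c.IsAlternating σ) (hs : StartsWith σ a.swap c) (hX : Extends c X)
    {p : Fin H.numEdges} (hp : X (σ p) = some a) (hlt : ∀ k ≤ p, c (σ k) = none) :
    ∃ d : H.PartialColoring, d.IsAlternating σ ∧ StartsWith σ a d ∧ Extends d X ∧
      d.length = c.length + 1 := by
  let d : H.PartialColoring := Function.update c (σ p) (some a)
  have dp : d (σ p) = some a := by simp [d]
  have dne : ∀ {k}, k ≠ p → d (σ k) = c (σ k) := fun {k} hk => by simp [d, hk]
  have dlt : ∀ {k}, d (σ k) ≠ none → p ≤ k := fun {k} hk => by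
    by_contra! hkp
    exact hk ((dne hkp.ne).trans (hlt k hkp.le))
  refine ⟨d, ?_, ?_, ?_, ?_⟩
  · intro i j hij hi hj hk
    have hjp : j ≠ p := ((dlt hi).trans_lt hij).ne'
    rw [dne hjp] at hj ⊢
    by_cases hip : i = p
    · subst hip
      rw [dp, hs j hj]
      · simpa using (Color.swap_ne a).symm
      · intro k hkj
        by_cases hki : k ≤ i
        · exact hlt k hki
        · rw [← dne (k := k) (by rintro rfl; exact hki le_rfl)]
          exact hk k (not_le.1 hki) hkj
    · rw [dne hip] at hi ⊢
      refine h i j hij hi hj fun k hik hkj => ?_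
      rw [← dne (k := k) (by rintro rfl; exact hi (hlt i hik.le))]
      exact hk k hik hkj
  · intro i hi hk
    rcases (dlt hi).eq_or_lt with rfl | hpi
    · exact dp
    · have := hk p hpi
      simp [dp] at this
  · intro e b he
    by_cases hep : e = σ p
    · subst hep
      rw [dp] at he
      rw [hp, he]
    · exact hX e b (by simpa [d, hep] using he)
  · have := H.finite_E
    have hset : {e | d e ≠ none} = insert (σ p) {e | c e ≠ none} := by
      ext e
      by_cases hep : e = σ p
      · simp [hep, dp]
      · simp [hep, d]
    rw [PartialColoring.length, hset, Set.ncard_insert_of_notMem]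
    · rfl
    · simpa using hlt p le_rfl

/-- Lets `redAltLength σ (swapColors X)` be read as the best length in `X` itself when starting with
blue. -/
theorem exists_blue_length_eq (σ : H.Ordering) (X : H.PartialColoring) :
    ∃ c : H.PartialColoring, c.IsAlternating σ ∧ StartsWith σ Color.blue c ∧
      Extends c X ∧ c.length = redAltLength σ (swapColors X) := by
  obtain ⟨c, h1, h2, h3, h4⟩ := exists_length_eq_redAltLength σ (swapColors X)
  exact ⟨swapColors c, IsAlternating.swapColors h1, h2.swapColors,
    by simpa using h3.swapColors, by rw [length_swapColors, h4]⟩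

theorem exists_first {σ : H.Ordering} {c : H.PartialColoring} (h : c ≠ fun _ => none) :
    ∃ p, c (σ p) ≠ none ∧ ∀ k < p, c (σ k) = none := by
  obtain ⟨e, he⟩ := Function.ne_iff.1 h
  have hne : (Finset.univ.filter fun k => c (σ k) ≠ none).Nonempty :=
    ⟨σ.symm e, by simpa using he⟩
  refine ⟨_, (Finset.mem_filter.1 (Finset.min'_mem _ hne)).2, fun k hk => ?_⟩
  by_contra hck
  exact absurd (Finset.min'_le _ k (by simpa using hck)) (not_le.2 hk)

/-- If the first colored hyperedge of `X` is red, a longest subcoloring starting with blue lies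
strictly after it and can be prolonged by it, so starting with red is strictly better. The other
case is antipodal. -/
theorem redAltLength_ne {σ : H.Ordering} {X : H.PartialColoring} (hX : X ≠ fun _ => none) :
    redAltLength σ X ≠ redAltLength σ (swapColors X) := by
  obtain ⟨p, hp, hlt⟩ := exists_first (σ := σ) hX
  have main : ∀ Y : H.PartialColoring, Y (σ p) = some Color.red →
      (∀ k < p, Y (σ k) = none) → redAltLength σ Y ≠ redAltLength σ (swapColors Y) := by
    intro Y hY hlt
    obtain ⟨c, h1, h2, h3, h4⟩ := exists_blue_length_eq σ Y
    -- If `c` colored `σ p`, that would be its first hyperedge, hence blue, whereas `Y` makes it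
    -- red.
    have hnone : ∀ k ≤ p, c (σ k) = none := by
      have hk' : ∀ k < p, c (σ k) = none := by
        intro k hk
        by_contra hck
        obtain ⟨a, ha⟩ := Option.ne_none_iff_exists'.1 hck
        simpa [hlt k hk] using h3 _ _ ha
      intro k hk
      rcases hk.eq_or_lt with rfl | hk
      · by_contra hck
        have := h3 _ _ (h2 k hck hk')
        simp [hY] at this
      · exact hk' k hk
    obtain ⟨d, d1, d2, d3, d4⟩ := exists_prepend (a := Color.red) h1 h2 h3 hY hnone
    have := length_le_redAltLength d1 d2 d3
    omega
  obtain ⟨a, ha⟩ := Option.ne_none_iff_exists'.1 hp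
  cases a with
  | red => exact main X ha hlt
  | blue =>
    have := main (swapColors X) (swapColors_eq_some.2 ha)
      (fun k hk => swapColors_eq_none.2 (hlt k hk))
    rw [swapColors_swapColors] at this
    exact this.symm

end Alternating

/-! ### Colors of monochromatic copies, and the lower bounds -/

section LowerBound

/-- The largest number (counted from 1) of a color of a member of `H.choose 𝓕` inside the red
hyperedges of `X`; it is 0 if there is no such member. -/
noncomputable def redMaxColor {t : ℕ} (C : (H.choose 𝓕).kneserGraph.Coloring (Fin t))
    (X : H.PartialColoring) : ℕ :=
  sSup {l | ∃ A : (H.choose 𝓕).E, A.1 ⊆ X.colorClass Color.red ∧ (C A : ℕ) + 1 = l}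

variable {t : ℕ} (C : (H.choose 𝓕).kneserGraph.Coloring (Fin t))

theorem redMaxColor_bddAbove (X : H.PartialColoring) :
    BddAbove {l | ∃ A : (H.choose 𝓕).E, A.1 ⊆ X.colorClass Color.red ∧ (C A : ℕ) + 1 = l} :=
  ⟨t, by rintro _ ⟨A, -, rfl⟩; exact (C A).2⟩

theorem lt_redMaxColor {X : H.PartialColoring} {A : (H.choose 𝓕).E}
    (h : A.1 ⊆ X.colorClass Color.red) : (C A : ℕ) < redMaxColor C X :=
  le_csSup (redMaxColor_bddAbove C X) ⟨A, h, rfl⟩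

theorem exists_color_eq_redMaxColor {X : H.PartialColoring} (h : redMaxColor C X ≠ 0) :
    ∃ A : (H.choose 𝓕).E, A.1 ⊆ X.colorClass Color.red ∧ (C A : ℕ) + 1 = redMaxColor C X := by
  refine Nat.sSup_mem ?_ (redMaxColor_bddAbove C X)
  by_contra hne
  rw [Set.not_nonempty_iff_eq_empty] at hne
  exact h (by rw [redMaxColor, hne]; exact csSup_empty)

theorem redMaxColor_le (X : H.PartialColoring) : redMaxColor C X ≤ t := by
  by_cases h : redMaxColor C X = 0
  · omega
  · obtain ⟨A, -, hA⟩ := exists_color_eq_redMaxColor C h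
    have := (C A).2
    omega

theorem redMaxColor_mono {X Y : H.PartialColoring} (h : Extends X Y) :
    redMaxColor C X ≤ redMaxColor C Y := by
  by_cases h0 : redMaxColor C X = 0
  · omega
  · obtain ⟨A, hA, hA'⟩ := exists_color_eq_redMaxColor C h0
    have := lt_redMaxColor C (X := Y) (A := A) fun e he => h e _ (hA he)
    omega

/-- Equal nonzero values would give a red copy and a blue copy of the same color, yet these are
disjoint and so adjacent. -/
theorem redMaxColor_ne {X : H.PartialColoring}
    (h : redMaxColor C X ≠ 0 ∨ redMaxColor C (swapColors X) ≠ 0) :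
    redMaxColor C X ≠ redMaxColor C (swapColors X) := by
  intro heq
  obtain ⟨A, hA, hA'⟩ := exists_color_eq_redMaxColor C (X := X) (by omega)
  obtain ⟨B, hB, hB'⟩ := exists_color_eq_redMaxColor C (X := swapColors X) (by omega)
  have hdisj : (H.choose 𝓕).kneserGraph.Adj A B := by
    refine Set.disjoint_left.2 fun e heA heB => ?_
    have h1 : X e = some Color.red := hA heA
    have h2 := swapColors_eq_some.1 (hB heB)
    rw [h1] at h2
    cases h2
  exact C.valid hdisj (Fin.ext (by omega))

theorem redMaxColor_ne_zero (h𝓕 : ∀ F ∈ 𝓕, Nonempty F.E) {c X : H.PartialColoring}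
    (hc : ¬ (c.colorSub Color.red).IsFree 𝓕) (h : Extends c X) : redMaxColor C X ≠ 0 := by
  rw [PartialColoring.colorSub, spanningSub_isFree_iff h𝓕] at hc
  push Not at hc
  obtain ⟨A, hA⟩ := hc
  have := lt_redMaxColor C (X := X) (A := A) fun e he => h e _ (hA he)
  omega

theorem redMaxColor_swapColors_ne_zero (h𝓕 : ∀ F ∈ 𝓕, Nonempty F.E) {c X : H.PartialColoring}
    (hc : ¬ (c.colorSub Color.blue).IsFree 𝓕) (h : Extends c X) :
    redMaxColor C (swapColors X) ≠ 0 := by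
  refine redMaxColor_ne_zero C h𝓕 (c := swapColors c) ?_ h.swapColors
  have : PartialColoring.colorClass (swapColors c) Color.red = c.colorClass Color.blue := by
    ext e
    exact swapColors_eq_some
  rwa [PartialColoring.colorSub, this]

/-- The common part of the two lower bounds. -/
theorem numEdges_le_of_alternating (σ : H.Ordering) (α k : ℕ)
    (hne : ∀ c X : H.PartialColoring, c.IsAlternating σ → α < c.length → Extends c X →
      redMaxColor C X - k ≠ redMaxColor C (swapColors X) - k) :
    H.numEdges ≤ α + (t - k) := by
  classical
  have := H.finite_E
  have := Fintype.ofFinite H.E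
  have hbig : ∀ X : H.PartialColoring,
      α < redAltLength σ X ∨ α < redAltLength σ (swapColors X) →
      redMaxColor C X - k ≠ redMaxColor C (swapColors X) - k := by
    rintro X (h | h)
    · obtain ⟨c, h1, -, h3, h4⟩ := exists_length_eq_redAltLength σ X
      exact hne c X h1 (by omega) h3
    · obtain ⟨c, h1, -, h3, h4⟩ := exists_blue_length_eq σ X
      exact hne c X h1 (by omega) h3
  rw [numEdges, Nat.card_eq_fintype_card]
  -- The case condition is antipodally symmetric and passes to extensions. Crossing it keeps
  -- monotonicity: values below the threshold are at most `α`, those above at least `α`.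
  refine card_le_of_monotone_of_antipodal (fun X : H.PartialColoring =>
    if α < redAltLength σ X ∨ α < redAltLength σ (swapColors X) then α + (redMaxColor C X - k)
    else redAltLength σ X) ?_ ?_ ?_
  · intro X Y hXY
    have h1 := redAltLength_mono (σ := σ) hXY
    have h2 := redAltLength_mono (σ := σ) hXY.swapColors
    have h3 := redMaxColor_mono C hXY
    split_ifs <;> omega
  · intro X hX
    have h1 := redAltLength_ne (σ := σ) hX
    have h2 := hbig X
    simp only [swapColors_swapColors]
    split_ifs with h h' h'
    · have := h2 h
      omega
    · omega
    · omega
    · exact h1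
  · intro X
    have := redMaxColor_le C X
    split_ifs <;> omega

end LowerBound

theorem numEdges_le_add_exAltOrd {t : ℕ} (C : (H.choose 𝓕).kneserGraph.Coloring (Fin t))
    (h𝓕 : ∀ F ∈ 𝓕, Nonempty F.E) (σ : H.Ordering) :
    H.numEdges ≤ H.exAltOrd 𝓕 σ + t := by
  refine numEdges_le_of_alternating C σ _ 0 fun c X hc hlen hX => redMaxColor_ne C ?_
  by_contra! h
  refine absurd hlen (not_lt.2 (le_csSup ⟨H.numEdges, ?_⟩ ⟨c, hc, ⟨?_, ?_⟩, rfl⟩))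
  · rintro _ ⟨d, -, -, rfl⟩
    exact d.length_le
  · by_contra hfree
    exact redMaxColor_ne_zero C h𝓕 hfree hX h.1
  · by_contra hfree
    exact redMaxColor_swapColors_ne_zero C h𝓕 hfree hX h.2

theorem numEdges_le_add_exSaltOrd {t : ℕ} (C : (H.choose 𝓕).kneserGraph.Coloring (Fin t))
    (h𝓕 : ∀ F ∈ 𝓕, Nonempty F.E) (σ : H.Ordering) :
    H.numEdges ≤ H.exSaltOrd 𝓕 σ + (t - 1) := by
  refine numEdges_le_of_alternating C σ _ 1 fun c X hc hlen hX => ?_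
  have hfree : ¬ ((c.colorSub Color.red).IsFree 𝓕 ∨ (c.colorSub Color.blue).IsFree 𝓕) := by
    intro h
    refine absurd hlen (not_lt.2 (le_csSup ⟨H.numEdges, ?_⟩ ⟨c, hc, h, rfl⟩))
    rintro _ ⟨d, -, -, rfl⟩
    exact d.length_le
  push Not at hfree
  have h1 := redMaxColor_ne_zero C h𝓕 hfree.1 hX
  have h2 := redMaxColor_swapColors_ne_zero C h𝓕 hfree.2 hX
  have h3 := redMaxColor_ne C (Or.inl h1)
  -- Both maxima are positive, so truncated subtraction of 1 keeps them distinct.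
  omega

theorem nonempty_ordering (H : MultiHypergraph.{u}) : Nonempty H.Ordering := by
  have := H.finite_E
  exact ⟨(Finite.equivFin H.E).symm⟩

theorem exists_coloring_chromaticNumber (H : MultiHypergraph.{u}) : ∃ t : ℕ,
    H.kneserGraph.chromaticNumber = t ∧ Nonempty (H.kneserGraph.Coloring (Fin t)) := by
  have := H.finite_E
  have := Fintype.ofFinite H.E
  have hcol := H.kneserGraph.colorable_of_fintype
  obtain ⟨t, ht⟩ := ENat.ne_top_iff_exists.1
    (SimpleGraph.chromaticNumber_ne_top_iff_exists.2 ⟨_, hcol⟩)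
  exact ⟨t, ht.symm, SimpleGraph.chromaticNumber_le_iff_colorable.1 ht.symm.le⟩

end Hypergraphs

end MultiHypergraph

theorem mainTheorem7 (H : MultiHypergraph.{u}) (𝓕 : Set MultiHypergraph.{v})
    (h𝓕 : ∀ F ∈ 𝓕, Nonempty F.E) :
    ((H.numEdges : ℕ∞) ≤ (H.choose 𝓕).kneserGraph.chromaticNumber + (H.exAlt 𝓕 : ℕ∞) ∧
      (H.choose 𝓕).kneserGraph.chromaticNumber + (H.ex 𝓕 : ℕ∞) ≤ (H.numEdges : ℕ∞)) ∧
    (¬ H.IsFree 𝓕 →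
      (H.numEdges : ℕ∞) + 1 ≤
          (H.choose 𝓕).kneserGraph.chromaticNumber + (H.exSalt 𝓕 : ℕ∞) ∧
        (H.choose 𝓕).kneserGraph.chromaticNumber + (H.ex 𝓕 : ℕ∞) ≤ (H.numEdges : ℕ∞)) := by
  have hupper := MultiHypergraph.chromaticNumber_add_ex_le (H := H) h𝓕
  have := H.nonempty_ordering
  obtain ⟨t, ht, ⟨C⟩⟩ := (H.choose 𝓕).exists_coloring_chromaticNumber
  refine ⟨⟨?_, hupper⟩, fun hfree => ⟨?_, hupper⟩⟩
  · obtain ⟨σ, hσ⟩ : ∃ σ, H.exAltOrd 𝓕 σ = H.exAlt 𝓕 := Nat.sInf_mem (Set.range_nonempty _)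
    have := MultiHypergraph.numEdges_le_add_exAltOrd C h𝓕 σ
    rw [ht, ← hσ]
    exact_mod_cast this.trans_eq (add_comm _ _)
  · obtain ⟨σ, hσ⟩ : ∃ σ, H.exSaltOrd 𝓕 σ = H.exSalt 𝓕 := Nat.sInf_mem (Set.range_nonempty _)
    have := MultiHypergraph.numEdges_le_add_exSaltOrd C h𝓕 σ
    obtain ⟨A⟩ := MultiHypergraph.nonempty_choose_edges h𝓕 hfree
    -- A copy exists, so `t` is at least 1 and `t - 1` is not truncated.
    have hpos := (C A).pos
    rw [ht, ← hσ]
    have : H.numEdges + 1 ≤ t + H.exSaltOrd 𝓕 σ := by omega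
    exact_mod_cast this
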